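/- A digraph $D=(V,A)$ consists of a finite set $V$ of vertices and a finite set $A$ of arcs, each arc having an origin and a target in $V$; loops and multiple arcs are allowed. $D$ is *acyclic* if it has no directed cycle (a loop is a directed cycle), and *totally cyclic* if each of its arcs lies in a directed cycle. Let $v(D)$ be the number of vertices of $D$, and $c(D)$ the number of connected components of its underlying graph. For disjoint $R,T\subseteq A$, let $D^{-T}_{\setminus R}$ (respectively $D^{-T}_{/R}$) be the digraph obtained from $D$ by reversing the arcs in $T$ and deleting the arcs in $R$ (respectively, contracting the arcs in $R$, that is, removing them and identifying their endpoints); $T$ or $R$ is omitted from the notation when empty. The $B$-polynomial of $D$ is the unique polynomial $B_D(q,y,z)$ with rational coefficients such that, for every positive integer $q$, $$B_D(q,y,z)=\sum_{f:V\to\{1,\dots,q\}}y^{\#\{(u,v)\in A\,:\,f(v)>f(u)\}}\,z^{\#\{(u,v)\in A\,:\,f(v)<f(u)\}}.$$ **Theorem.** For every digraph $D=(V,A)$, where $R\uplus S\uplus T=A$ means that $(R,S,T)$ ranges over the ordered partitions of $A$ into three possibly empty sets, $$\sum_{\substack{R\uplus S\uplus T=A\\ D^{-T}_{\setminus R}\text{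 acyclic}}}y^{|S|}z^{|T|}=(-1)^{|V|}B_D(-1,1+y,1+z),$$ $$\sum_{\substack{R\uplus S\uplus T=A\\ D^{-T}_{\setminus R}\text{ totally cyclic}}}y^{|S|}z^{|T|}(-1)^{c(D^{-T}_{\setminus R})}=(1+y+z)^{|A|}B_D\Bigl(-1,\tfrac{1+y}{1+y+z},\tfrac{1+z}{1+y+z}\Bigr),$$ $$\sum_{\substack{R\uplus S\uplus T=A\\ D^{-T}_{/R}\text{ acyclic}}}y^{|S|}z^{|T|}(-1)^{v(D^{-T}_{/R})}=B_D(-1,y,z),$$ $$\sum_{\substack{R\uplus S\uplus T=A\\ D^{-T}_{/R}\text{ totally cyclic}}}y^{|S|}z^{|T|}=(-1)^{c(D)}(1+y+z)^{|A|}B_D\Bigl(-1,\tfrac{y}{1+y+z},\tfrac{z}{1+y+z}\Bigr).$$ Moreover, writing $[z^k]P$ for the coefficient of $z^k$ in $P$, $$\sum_{\substack{S\subseteq A\\ D^{-S}\text{ acyclic}}}y^{|S|}=(-1)^{|V|}[z^{|A|}]B_D(-1,yz,z),\qquad \sum_{\substack{S\subseteq A\\ D_{\setminus S}\text{ acyclic}}}y^{|A\setminus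 S|}=(-1)^{|V|}B_D(-1,1+y,1),$$ $$\sum_{\substack{S\subseteq A\\ D^{-S}\text{ totally cyclic}}}y^{|S|}=(-1)^{c(D)}(1+y)^{|A|}B_D\Bigl(-1,\tfrac{y}{1+y},\tfrac{1}{1+y}\Bigr),\qquad \sum_{\substack{S\subseteq A\\ D_{/S}\text{ totally cyclic}}}y^{|A\setminus S|}=(-1)^{c(D)}(1+y)^{|A|}B_D\Bigl(-1,\tfrac{y}{1+y},0\Bigr).$$ These identities hold for all $y,z$ in any field of characteristic $0$ (in particular for indeterminates $y,z$), provided that the denominators that occur are nonzero. -/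

import Mathlib

/-- A directed graph with vertex set `V` and arc set `A`; loops and multiple arcs are allowed
(several labels in `A` may carry the same ordered pair of vertices). -/
structure MultiDigraph (V A : Type*) where
  /-- the origin of an arc -/
  src : A → V
  /-- the target of an arc -/
  tgt : A → V

namespace MultiDigraph

variable {V A : Type*}

/-- `u` and `v` are the origin and the target of some arc belonging to `R`. -/
def JoinedBy (D : MultiDigraph V A) (R : Set A) (u v : V) : Prop :=
  ∃ a ∈ R, D.src a = u ∧ D.tgt a = v

/-- Deletion of the arcs in `R`. -/
def delete (D : MultiDigraph V A) (R : Finset A) : MultiDigraph V {a : A // a ∉ R} where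
  src a := D.src a
  tgt a := D.tgt a

/-- Contraction of the arcs in `R`: they are removed, and their endpoints are identified.
(`Quot r` is the quotient by the equivalence relation generated by `r`.) -/
def contract (D : MultiDigraph V A) (R : Finset A) :
    MultiDigraph (Quot (D.JoinedBy (R : Set A))) {a : A // a ∉ R} where
  src a := Quot.mk _ (D.src a)
  tgt a := Quot.mk _ (D.tgt a)

/-- Reorientation of the arcs in `T`: each `(u, v)` with label in `T` becomes `(v, u)`. -/
def reorient [DecidableEq A] (D : MultiDigraph V A) (T : Finset A) : MultiDigraph V A where
  src a := if a ∈ T then D.tgt a else D.src a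
  tgt a := if a ∈ T then D.src a else D.tgt a

/-- The number of vertices. -/
noncomputable def vertexCount (_D : MultiDigraph V A) : ℕ := Nat.card V

/-- The number of connected components of the underlying graph. -/
noncomputable def componentCount (D : MultiDigraph V A) : ℕ :=
  Nat.card (Quot (D.JoinedBy Set.univ))

/-- A directed cycle: a nonempty cyclic sequence of arcs in which the target of each arc is the
origin of the next one, and which visits each vertex at most once. A loop is a directed cycle of
length one. -/
def IsDirectedCycle (D : MultiDigraph V A) (c : Cycle A) : Prop :=
  c ≠ Cycle.nil ∧ c.Chain (fun a b => D.tgt a = D.src b) ∧ (c.map D.src).Nodup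

/-- An arc is cyclic if it is in a directed cycle. -/
def IsCyclicArc (D : MultiDigraph V A) (a : A) : Prop :=
  ∃ c : Cycle A, D.IsDirectedCycle c ∧ a ∈ c

/-- No directed cycle. -/
def IsAcyclic (D : MultiDigraph V A) : Prop := ∀ c : Cycle A, ¬ D.IsDirectedCycle c

/-- Every arc is in a directed cycle. -/
def IsTotallyCyclic (D : MultiDigraph V A) : Prop := ∀ a : A, D.IsCyclicArc a

noncomputable instance (D : MultiDigraph V A) : Decidable D.IsAcyclic := Classical.dec _

noncomputable instance (D : MultiDigraph V A) : Decidable D.IsTotallyCyclic := Classical.dec _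

/-- The ordered triples `(R, S, T)` with `R ⊎ S ⊎ T = A`. -/
def triPartitions (A : Type*) [Fintype A] [DecidableEq A] :
    Finset (Finset A × Finset A × Finset A) :=
  {p | Disjoint p.1 p.2.1 ∧ Disjoint p.1 p.2.2 ∧ Disjoint p.2.1 p.2.2 ∧
    p.1 ∪ p.2.1 ∪ p.2.2 = Finset.univ}

section Coloring

variable [Fintype A]

/-- The ascents of a coloring: the arcs `(u, v)` with `f v > f u`. -/
def ascents {q : ℕ} (D : MultiDigraph V A) (f : V → Fin q) : Finset A :=
  {a | f (D.tgt a) > f (D.src a)}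

/-- The descents of a coloring: the arcs `(u, v)` with `f v < f u`. -/
def descents {q : ℕ} (D : MultiDigraph V A) (f : V → Fin q) : Finset A :=
  {a | f (D.tgt a) < f (D.src a)}

variable [Fintype V] [DecidableEq V]

/-- The defining property of the `B`-polynomial, in the variables `0 = q`, `1 = y`, `2 = z`:
for all positive integers `q`, it counts the `q`-colorings by ascents and descents. -/
def IsBPolynomial (D : MultiDigraph V A) (B : MvPolynomial (Fin 3) ℚ) : Prop :=
  ∀ q : ℕ, 0 < q → ∀ y z : ℚ,
    MvPolynomial.eval ![(q : ℚ), y, z] B =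
      ∑ f : V → Fin q, y ^ (D.ascents f).card * z ^ (D.descents f).card

/-- The `B`-polynomial, written out as
`∑ p, q (q - 1) ⋯ (q - p + 1) / p! * ∑ g : V ↠ [p], y ^ asc g * z ^ desc g`;
`isBPolynomial_iff` below shows that it is the only polynomial with the defining property. -/
noncomputable def bPoly (D : MultiDigraph V A) : MvPolynomial (Fin 3) ℚ :=
  ∑ p ∈ Finset.range (Fintype.card V + 1),
    MvPolynomial.C (1 / (p.factorial : ℚ)) *
      (∏ i ∈ Finset.range p, (MvPolynomial.X 0 - MvPolynomial.C (i : ℚ))) *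
      ∑ g : V → Fin p with Function.Surjective g,
        MvPolynomial.X 1 ^ (D.ascents g).card * MvPolynomial.X 2 ^ (D.descents g).card

theorem sum_colorings_of_image_eq (D : MultiDigraph V A) {q p : ℕ} (s : Finset (Fin q))
    (hs : s.card = p) (y z : ℚ) :
    ∑ f : V → Fin q with Finset.univ.image f = s,
        y ^ (D.ascents f).card * z ^ (D.descents f).card =
      ∑ g : V → Fin p with Function.Surjective g,
        y ^ (D.ascents g).card * z ^ (D.descents g).card := by
  symm
  refine Finset.sum_bij (fun g _ => fun v => s.orderEmbOfFin hs (g v)) ?_ ?_ ?_ ?_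
  · intro g hg
    simp only [Finset.mem_filter, Finset.mem_univ, true_and] at hg ⊢
    ext x
    have hx : x ∈ Set.range (s.orderEmbOfFin hs) ↔ x ∈ s := by simp
    rw [← hx]
    simp only [Finset.mem_image, Finset.mem_univ, true_and, Set.mem_range]
    constructor
    · rintro ⟨v, rfl⟩
      exact ⟨_, rfl⟩
    · rintro ⟨i, rfl⟩
      obtain ⟨v, rfl⟩ := hg i
      exact ⟨v, rfl⟩
  · intro g _ g' _ h
    funext v
    exact (s.orderEmbOfFin hs).injective (congrFun h v)
  · intro f hf
    simp only [Finset.mem_filter, Finset.mem_univ, true_and] at hf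
    have hm : ∀ v, ∃ i, s.orderEmbOfFin hs i = f v := by
      intro v
      have : f v ∈ Set.range (s.orderEmbOfFin hs) := by
        rw [Finset.range_orderEmbOfFin, ← hf]
        simp
      exact this
    choose g hg using hm
    refine ⟨g, ?_, funext hg⟩
    simp only [Finset.mem_filter, Finset.mem_univ, true_and]
    intro i
    have hi : s.orderEmbOfFin hs i ∈ Finset.univ.image f := by
      rw [hf]
      exact Finset.orderEmbOfFin_mem s hs i
    obtain ⟨v, -, hv⟩ := Finset.mem_image.1 hi
    exact ⟨v, (s.orderEmbOfFin hs).injective (by rw [hg, hv])⟩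
  · intro g _
    simp [ascents, descents]

theorem isBPolynomial_bPoly (D : MultiDigraph V A) : D.IsBPolynomial D.bPoly := by
  intro q _ y z
  have hmap : ∀ f ∈ (Finset.univ : Finset (V → Fin q)),
      (Finset.univ.image f).card ∈ Finset.range (Fintype.card V + 1) := by
    intro f _
    rw [Finset.mem_range, Nat.lt_succ_iff]
    exact Finset.card_image_le
  rw [← Finset.sum_fiberwise_of_maps_to hmap, bPoly, map_sum]
  refine Finset.sum_congr rfl fun p _ => ?_
  have hmap2 : ∀ f ∈ (Finset.univ : Finset (V → Fin q)).filter
      (fun f => (Finset.univ.image f).card = p),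
      Finset.univ.image f ∈ Finset.powersetCard p (Finset.univ : Finset (Fin q)) := by
    intro f hf
    simpa [Finset.mem_powersetCard] using hf
  rw [← Finset.sum_fiberwise_of_maps_to hmap2]
  have hin : ∀ s ∈ Finset.powersetCard p (Finset.univ : Finset (Fin q)),
      ∑ f ∈ ((Finset.univ : Finset (V → Fin q)).filter
          (fun f => (Finset.univ.image f).card = p)).filter (fun f => Finset.univ.image f = s),
        y ^ (D.ascents f).card * z ^ (D.descents f).card =
      ∑ g : V → Fin p with Function.Surjective g,
        y ^ (D.ascents g).card * z ^ (D.descents g).card := by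
    intro s hs
    have hc := (Finset.mem_powersetCard.1 hs).2
    rw [← D.sum_colorings_of_image_eq s hc, Finset.filter_filter]
    refine Finset.sum_congr (Finset.filter_congr fun f _ => ?_) fun _ _ => rfl
    constructor
    · exact fun h => h.2
    · intro h
      exact ⟨by rw [h, hc], h⟩
  rw [Finset.sum_congr rfl hin, Finset.sum_const, Finset.card_powersetCard, Finset.card_univ,
    Fintype.card_fin, nsmul_eq_mul]
  have hch : (q.choose p : ℚ) =
      1 / (p.factorial : ℚ) * ∏ i ∈ Finset.range p, ((q : ℚ) - (i : ℚ)) := by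
    rw [← descPochhammer_eval_eq_prod_range, descPochhammer_eval_eq_descFactorial,
      Nat.descFactorial_eq_factorial_mul_choose]
    have : (p.factorial : ℚ) ≠ 0 := by exact_mod_cast p.factorial_ne_zero
    push_cast
    field_simp
  rw [hch]
  simp [map_prod]

theorem isBPolynomial_iff (D : MultiDigraph V A) (B : MvPolynomial (Fin 3) ℚ) :
    D.IsBPolynomial B ↔ B = D.bPoly := by
  constructor
  · intro h
    refine MvPolynomial.funext_set
      ![Set.range (fun n : ℕ => ((n + 1 : ℕ) : ℚ)), Set.univ, Set.univ] ?_ ?_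
    · intro i
      fin_cases i
      · exact Set.infinite_range_of_injective fun a b hab => by simpa using hab
      · exact Set.infinite_univ
      · exact Set.infinite_univ
    · intro x hx
      obtain ⟨n, hn⟩ := hx 0 (Set.mem_univ _)
      have hxe : x = ![((n + 1 : ℕ) : ℚ), x 1, x 2] := by
        funext i
        fin_cases i
        · exact hn.symm
        · rfl
        · rfl
      rw [hxe, h (n + 1) n.succ_pos, D.isBPolynomial_bPoly (n + 1) n.succ_pos]
  · rintro rfl
    exact D.isBPolynomial_bPoly

/-- The value `B_D(q, y, z)` of the `B`-polynomial at elements of a commutative `ℚ`-algebra. -/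
noncomputable def bEval {K : Type*} [CommRing K] [Algebra ℚ K] (D : MultiDigraph V A)
    (q y z : K) : K :=
  MvPolynomial.aeval ![q, y, z] D.bPoly

end Coloring

end MultiDigraph

/-!
At `q = -1` every `q choose p` is `(-1) ^ p`, so that `B_D(-1, y, z)` is a signed sum over the
ordered set partitions of `V` of products of arc weights. Such a sum is affine in the weight of each
arc. An arc of weight `1` may be deleted, an arc whose weight is the indicator of equal colors may
be contracted, and exchanging the weights of ascents and descents reverses an arc. Writing the
weights as combinations of these therefore expands the right-hand sides into sums over `(R, S, T)`,
and only two evaluations are left.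

* For the indicator of colorings that are strictly increasing along all arcs, the top block of an
  ordered partition is a nonempty set of sinks; removing it and summing the alternating signs gives
  `(-1) ^ |V|` by induction if `D` is acyclic. There is no such coloring otherwise.
* Weakly increasing colorings are constant on directed cycles, so the cyclic arcs may be contracted.
  For acyclic `D`, inclusion-exclusion over the strict descents reduces to the strict case and gives
  `0` as soon as there is an arc. Hence the value is `(-1) ^ c(D)` if `D` is totally cyclic and `0`
  otherwise.
-/

namespace MultiDigraph

section ExtendLast

variable {V : Type*} [DecidableEq V] {U : Finset V} {p : ℕ}

/-- The coloring of `V` that extends `h` by a new top color outside `U`. -/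
def extendLast (h : U → Fin p) (v : V) : Fin (p + 1) :=
  if hv : v ∈ U then (h ⟨v, hv⟩).castSucc else Fin.last p

theorem extendLast_of_mem (h : U → Fin p) (v : U) : extendLast h v = (h v).castSucc := by
  simp [extendLast]

theorem extendLast_of_notMem (h : U → Fin p) {v : V} (hv : v ∉ U) :
    extendLast h v = Fin.last p := by
  simp [extendLast, hv]

theorem extendLast_ne_last_iff (h : U → Fin p) (v : V) : extendLast h v ≠ Fin.last p ↔ v ∈ U := by
  by_cases hv : v ∈ U <;> simp [extendLast, hv, (Fin.castSucc_lt_last _).ne]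

theorem surjective_extendLast [Fintype V] (hU : U ≠ Finset.univ) {h : U → Fin p}
    (hh : Function.Surjective h) : Function.Surjective (extendLast h) := by
  refine Fin.lastCases ?_ fun i => ?_
  · obtain ⟨v, hv⟩ := not_forall.1 fun h => hU (Finset.eq_univ_iff_forall.2 h)
    exact ⟨v, extendLast_of_notMem h hv⟩
  · obtain ⟨v, rfl⟩ := hh i
    exact ⟨v, extendLast_of_mem h v⟩

theorem strict_extendLast_iff {r : V → V → Prop} (h : U → Fin p) :
    (∀ u v, r u v → extendLast h u < extendLast h v) ↔
      (∀ u ∉ U, ∀ v, ¬ r u v) ∧ ∀ u v : U, r u v → h u < h v := by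
  constructor
  · refine fun H => ⟨fun u hu v huv => ?_, fun u v huv => ?_⟩
    · exact (Fin.le_last _).not_gt (extendLast_of_notMem h hu ▸ H u v huv)
    · simpa [extendLast_of_mem] using H u v huv
  · rintro ⟨sinks, strict⟩ u v huv
    have hu : u ∈ U := by_contra fun hu => sinks u hu v huv
    lift u to U using hu
    by_cases hv : v ∈ U
    · lift v to U using hv
      simpa [extendLast_of_mem] using strict u v huv
    · rw [extendLast_of_notMem h hv, extendLast_of_mem]
      exact Fin.castSucc_lt_last _

end ExtendLast

section AlternatingSum

variable {V K : Type*} [Fintype V] [DecidableEq V] [CommRing K]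

/-- The alternating sum `∑ p, (-1) ^ p * ∑ g : V ↠ [p], F g` over the ordered set partitions of
`V`. It is the value at `q = -1` of the polynomial `∑ p, (q choose p) * ∑ g : V ↠ [p], F g`, which
for a positive integer `q` is the sum of `F` over all maps `V → [q]` if `F` depends only on the
relative order of the values of its argument. -/
def alternatingSum (F : ∀ p, (V → Fin p) → K) : K :=
  ∑ p ∈ Finset.range (Fintype.card V + 1), (-1) ^ p *
    ∑ g : V → Fin p with Function.Surjective g, F p g

theorem alternatingSum_eq_sum_range {n : ℕ} (hn : Fintype.card V < n)
    (F : ∀ p, (V → Fin p) → K) :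
    alternatingSum F =
      ∑ p ∈ Finset.range n, (-1) ^ p * ∑ g : V → Fin p with Function.Surjective g, F p g := by
  refine Finset.sum_subset (Finset.range_mono hn) fun p _ hp => ?_
  have no_surjection (g : V → Fin p) : ¬ Function.Surjective g := fun hg => by
    have := Fintype.card_le_of_surjective g hg
    simp only [Fintype.card_fin, Finset.mem_range] at this hp
    omega
  simp [no_surjection]

theorem alternatingSum_sum {ι : Type*} (s : Finset ι) (c : ι → K)
    (F : ι → ∀ p, (V → Fin p) → K) :
    alternatingSum (fun p g => ∑ i ∈ s, c i * F i p g) =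
      ∑ i ∈ s, c i * alternatingSum (F i) := by
  simp only [alternatingSum, Finset.mul_sum]
  rw [Finset.sum_comm]
  refine Finset.sum_congr rfl fun p _ => ?_
  rw [Finset.sum_comm]
  exact Finset.sum_congr rfl fun g _ => Finset.sum_congr rfl fun i _ => mul_left_comm _ _ _

theorem alternatingSum_rev (F : ∀ p, (V → Fin p) → K) :
    alternatingSum (fun p g => F p (Fin.rev ∘ g)) = alternatingSum F := by
  refine Finset.sum_congr rfl fun p _ => congrArg _ ?_
  refine Finset.sum_equiv ((Equiv.refl V).arrowCongr Fin.revPerm) (fun g => ?_) fun _ _ => rfl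
  simp only [Finset.mem_filter_univ]
  exact (Fin.revPerm.comp_surjective g).symm

theorem alternatingSum_quot (r : V → V → Prop) [Fintype (Quot r)] [DecidableEq (Quot r)]
    [∀ p, DecidablePred fun g : V → Fin p => ∀ u v, r u v → g u = g v] (F : ∀ p, (V → Fin p) → K) :
    alternatingSum (fun p (g : Quot r → Fin p) => F p (g ∘ Quot.mk r)) =
      alternatingSum (fun p g => if ∀ u v, r u v → g u = g v then F p g else 0) := by
  rw [alternatingSum_eq_sum_range (Nat.lt_succ_of_le
    (Fintype.card_le_of_surjective _ Quot.mk_surjective)), alternatingSum]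
  refine Finset.sum_congr rfl fun p _ => congrArg _ ?_
  rw [← Finset.sum_filter, Finset.filter_filter]
  refine Finset.sum_bij (fun g _ => g ∘ Quot.mk r) ?_ ?_ ?_ fun _ _ => rfl
  · intro g hg
    simp only [Finset.mem_filter_univ] at hg ⊢
    exact ⟨hg.comp Quot.mk_surjective, fun u v h => congrArg g (Quot.sound h)⟩
  · exact fun g _ g' _ h => Quot.mk_surjective.injective_comp_right h
  · intro g hg
    simp only [Finset.mem_filter_univ] at hg
    exact ⟨Quot.lift g hg.2, by simpa using (Quot.surjective_lift hg.2).2 hg.1, rfl⟩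

theorem alternatingSum_of_isEmpty [IsEmpty V] (F : ∀ p, (V → Fin p) → K) :
    alternatingSum F = F 0 isEmptyElim := by
  have surjective (g : V → Fin 0) : Function.Surjective g := finZeroElim
  simp [alternatingSum, surjective, Subsingleton.elim default (isEmptyElim : V → Fin 0)]

theorem sum_surjective_succ (p : ℕ) (F : (V → Fin (p + 1)) → K) :
    ∑ g : V → Fin (p + 1) with Function.Surjective g, F g =
      ∑ U : Finset V with U ≠ Finset.univ,
        ∑ h : U → Fin p with Function.Surjective h, F (extendLast h) := by
  have lower_ne_univ (g : V → Fin (p + 1)) (hg : Function.Surjective g) :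
      ({v | g v ≠ Fin.last p} : Finset V) ≠ Finset.univ := by
    obtain ⟨v, hv⟩ := hg (Fin.last p)
    exact fun h => by simpa [hv] using Finset.ext_iff.1 h v
  rw [← Finset.sum_fiberwise_of_maps_to (t := {U : Finset V | U ≠ Finset.univ})
    (g := fun g => ({v | g v ≠ Fin.last p} : Finset V)) (by simpa using lower_ne_univ)]
  refine Finset.sum_congr rfl fun U hU => Eq.symm ?_
  rw [Finset.mem_filter_univ] at hU
  refine Finset.sum_bij (fun h _ => extendLast h) (fun h hh => ?_) (fun h _ h' _ e => ?_)
    (fun g hg => ?_) fun _ _ => rfl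
  · simp only [Finset.mem_filter, Finset.mem_univ, true_and] at hh ⊢
    exact ⟨surjective_extendLast hU hh, by simp only [extendLast_ne_last_iff,
      Finset.filter_univ_mem]⟩
  · funext v
    simpa [extendLast_of_mem] using congrFun e v
  · simp only [Finset.mem_filter, Finset.mem_univ, true_and] at hg
    obtain ⟨hsurj, rfl⟩ := hg
    have hne (v : ({v | g v ≠ Fin.last p} : Finset V)) : g v ≠ Fin.last p :=
      (Finset.mem_filter.1 v.2).2
    refine ⟨fun v => (g v).castPred (hne v), ?_, ?_⟩
    · rw [Finset.mem_filter_univ]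
      intro i
      obtain ⟨v, hv⟩ := hsurj i.castSucc
      refine ⟨⟨v, by simp [hv, (Fin.castSucc_lt_last i).ne]⟩, by simp [hv]⟩
    · funext v
      by_cases hv : g v = Fin.last p <;> simp [extendLast, hv]

theorem alternatingSum_of_nonempty [Nonempty V] (F : ∀ p, (V → Fin p) → K) :
    alternatingSum F =
      -∑ U : Finset V with U ≠ Finset.univ,
        alternatingSum (fun p (h : U → Fin p) => F (p + 1) (extendLast h)) := by
  have card_lt {U : Finset V} (hU : U ≠ Finset.univ) : Fintype.card U < Fintype.card V := by
    simpa using Finset.card_lt_card (Finset.ssubset_univ_iff.2 hU)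
  rw [Finset.sum_congr rfl fun U hU => alternatingSum_eq_sum_range (card_lt (by simpa using hU)) _,
    Finset.sum_comm, alternatingSum, Finset.sum_range_succ']
  simp only [sum_surjective_succ, Finset.univ_eq_empty, Finset.filter_empty, Finset.sum_empty,
    mul_zero, add_zero, ← Finset.mul_sum, pow_succ, mul_neg_one, neg_mul, Finset.sum_neg_distrib]

theorem sum_neg_one_pow_card_of_compl_subset {s : Finset V} (hs : s.Nonempty) :
    ∑ U : Finset V with U ≠ Finset.univ, (if Uᶜ ⊆ s then (-1) ^ U.card else 0 : K) =
      -(-1) ^ Fintype.card V := by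
  have sum_all : ∑ U : Finset V, (if Uᶜ ⊆ s then (-1) ^ U.card else 0 : K) = 0 := by
    have neg_one_pow_compl (M : Finset V) :
        (-1 : K) ^ Mᶜ.card = (-1) ^ Fintype.card V * (-1) ^ M.card := by
      rw [← M.card_compl_add_card, pow_add, mul_assoc, ← mul_pow, neg_one_mul, neg_neg, one_pow,
        mul_one]
    have := congrArg (Int.cast : ℤ → K) (Finset.sum_powerset_neg_one_pow_card_of_nonempty hs)
    push_cast at this
    rw [← Equiv.sum_comp (compl_involutive (α := Finset V)).toPerm]
    simp only [Function.Involutive.coe_toPerm, compl_compl, neg_one_pow_compl,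
      ← Finset.sum_filter, ← Finset.mul_sum]
    rw [show ({M | M ⊆ s} : Finset (Finset V)) = s.powerset by ext; simp, this, mul_zero]
  rw [← Finset.sum_filter_add_sum_filter_not _ (· ≠ Finset.univ)] at sum_all
  rw [eq_neg_iff_add_eq_zero]
  simpa [Finset.filter_eq'] using sum_all

open Classical in
theorem alternatingSum_strict {V : Type*} [Fintype V] {r : V → V → Prop}
    (hr : WellFounded (Function.swap r)) :
    alternatingSum (fun _ (g : V → _) => if ∀ u v, r u v → g u < g v then (1 : K) else 0) =
      (-1) ^ Fintype.card V := by
  induction h : Fintype.card V using Nat.strong_induction_on generalizing V with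
  | _ n ih =>
  subst h
  rcases isEmpty_or_nonempty V with _ | _
  · simp [alternatingSum_of_isEmpty]
  obtain ⟨m, -, hm⟩ := hr.has_min Set.univ Set.univ_nonempty
  rw [alternatingSum_of_nonempty, neg_eq_iff_eq_neg,
    ← sum_neg_one_pow_card_of_compl_subset (s := {u | ∀ v, ¬ r u v})
      ⟨m, by simpa using hm⟩]
  refine Finset.sum_congr rfl fun U hU => ?_
  simp only [strict_extendLast_iff]
  split_ifs with hsinks
  · have card_lt : Fintype.card U < Fintype.card V := by
      simpa using Finset.card_lt_card (Finset.ssubset_univ_iff.2 ((Finset.mem_filter_univ U).1 hU))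
    rw [← Fintype.card_coe, ← ih _ card_lt (InvImage.wf Subtype.val hr) rfl]
    congr! with p h
    exact and_iff_right (by simpa [Finset.subset_iff] using hsinks)
  · have no_strict : ¬ ∀ u ∉ U, ∀ v, ¬ r u v := by simpa [Finset.subset_iff] using hsinks
    simp [no_strict, alternatingSum]

end AlternatingSum

section Reach

variable {V A : Type*} {D : MultiDigraph V A}

/-- `D.Reach u v` means that `D` has a directed walk, possibly of length `0`, from `u` to `v`. -/
abbrev Reach (D : MultiDigraph V A) : V → V → Prop :=
  Relation.ReflTransGen (D.JoinedBy Set.univ)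

/-- The list of arcs `l` is a directed walk from `u` to `v`. -/
def IsArcWalk (D : MultiDigraph V A) : V → List A → V → Prop
  | u, [], v => u = v
  | u, a :: l, v => D.src a = u ∧ D.IsArcWalk (D.tgt a) l v

theorem joinedBy_univ (D : MultiDigraph V A) (a : A) :
    D.JoinedBy Set.univ (D.src a) (D.tgt a) :=
  ⟨a, Set.mem_univ a, rfl, rfl⟩

theorem IsArcWalk.exists_suffix {u v x : V} {l : List A} (h : D.IsArcWalk u l v)
    (hl : (l.map D.src).Nodup) (hv : v ∉ l.map D.src) (hx : x ∈ l.map D.src) :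
    ∃ l', D.IsArcWalk x l' v ∧ (l'.map D.src).Nodup ∧ v ∉ l'.map D.src := by
  induction l generalizing u with
  | nil => simp at hx
  | cons a l ih =>
    by_cases hax : D.src a = x
    · exact ⟨a :: l, ⟨hax, h.2⟩, hl, hv⟩
    · simp only [List.map_cons, List.mem_cons, List.nodup_cons, not_or] at hl hv hx
      exact ih h.2 hl.2 hv.2 (hx.resolve_left fun e => hax e.symm)

theorem Reach.exists_isArcWalk_nodup {u v : V} (h : D.Reach u v) :
    ∃ l, D.IsArcWalk u l v ∧ (l.map D.src).Nodup ∧ v ∉ l.map D.src := by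
  induction h using Relation.ReflTransGen.head_induction_on with
  | refl => exact ⟨[], rfl, by simp, by simp⟩
  | head hab _ ih =>
    obtain ⟨a, -, rfl, rfl⟩ := hab
    obtain ⟨l, hw, hl, hv⟩ := ih
    by_cases hx : D.src a ∈ l.map D.src
    · exact hw.exists_suffix hl hv hx
    · by_cases hav : v = D.src a
      · exact ⟨[], hav.symm, by simp, by simp⟩
      · exact ⟨a :: l, ⟨rfl, hw⟩, by simpa using ⟨by simpa using hx, hl⟩,
          by simpa [hav] using hv⟩

theorem isArcWalk_iff_isChain (D : MultiDigraph V A) (a b : A) (l : List A) :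
    D.IsArcWalk (D.tgt a) l (D.src b) ↔
      (a :: (l ++ [b])).IsChain (fun a b => D.tgt a = D.src b) := by
  induction l generalizing a with
  | nil => simp [IsArcWalk]
  | cons c l ih => simp [IsArcWalk, ih c, eq_comm]

theorem IsArcWalk.reach {u v : V} {l : List A} (h : D.IsArcWalk u l v) : D.Reach u v := by
  induction l generalizing u with
  | nil => exact h ▸ .refl
  | cons a l ih => exact .head (h.1 ▸ D.joinedBy_univ a) (ih h.2)

theorem isCyclicArc_iff_reach (a : A) : D.IsCyclicArc a ↔ D.Reach (D.tgt a) (D.src a) := by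
  constructor
  · rintro ⟨c, ⟨-, hc, -⟩, ha⟩
    induction c using Cycle.induction_on with
    | nil => simp at ha
    | cons b l _ =>
      obtain ⟨l₁, l₂, hl⟩ := List.append_of_mem (Cycle.mem_coe_iff.1 ha)
      have rotated : ((b :: l : List A) : Cycle A) = ((a :: (l₂ ++ l₁) : List A) : Cycle A) := by
        rw [hl, Cycle.coe_eq_coe]
        exact List.isRotated_append
      rw [rotated, Cycle.chain_coe_cons] at hc
      exact ((D.isArcWalk_iff_isChain a a _).2 hc).reach
  · intro h
    obtain ⟨l, hw, hl, hv⟩ := h.exists_isArcWalk_nodup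
    refine ⟨((a :: l : List A) : Cycle A), ⟨by simp, ?_, ?_⟩, by simp⟩
    · rw [Cycle.chain_coe_cons]
      exact (D.isArcWalk_iff_isChain a a _).1 hw
    · rw [Cycle.map_coe, Cycle.nodup_coe_iff]
      simpa using ⟨by simpa using hv, hl⟩

theorem isAcyclic_iff_not_isCyclicArc : D.IsAcyclic ↔ ∀ a, ¬ D.IsCyclicArc a := by
  constructor
  · rintro h a ⟨c, hc, -⟩
    exact h c hc
  · intro h c hc
    induction c using Cycle.induction_on with
    | nil => exact hc.1 rfl
    | cons b l _ => exact h b ⟨_, hc, by simp⟩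

theorem isAcyclic_iff_not_reach : D.IsAcyclic ↔ ∀ a, ¬ D.Reach (D.tgt a) (D.src a) := by
  simp only [isAcyclic_iff_not_isCyclicArc, isCyclicArc_iff_reach]

theorem IsAcyclic.wellFounded [Finite V] (hD : D.IsAcyclic) :
    WellFounded (Function.swap (D.JoinedBy Set.univ)) := by
  have : Std.Irrefl (Relation.TransGen (Function.swap (D.JoinedBy Set.univ))) := ⟨fun v hv => by
    obtain ⟨w, ⟨a, -, rfl, rfl⟩, hw⟩ := Relation.TransGen.head'_iff.1 (Relation.transGen_swap.1 hv)
    exact isAcyclic_iff_not_reach.1 hD a hw⟩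
  exact (Finite.wellFounded_of_trans_of_irrefl _).mono fun _ _ => Relation.TransGen.single

theorem IsAcyclic.delete (hD : D.IsAcyclic) (R : Finset A) : (D.delete R).IsAcyclic := by
  rw [isAcyclic_iff_not_reach] at hD ⊢
  refine fun a h => hD a (Relation.ReflTransGen.mono ?_ _ _ h)
  rintro _ _ ⟨b, -, rfl, rfl⟩
  exact D.joinedBy_univ b

theorem Reach.le_of_monotone {α : Type*} [Preorder α] {g : V → α}
    (hg : ∀ a, g (D.src a) ≤ g (D.tgt a)) {u v : V} (h : D.Reach u v) : g u ≤ g v := by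
  induction h with
  | refl => exact le_rfl
  | tail _ hvw ih =>
    obtain ⟨a, -, rfl, rfl⟩ := hvw
    exact ih.trans (hg a)

theorem reach_of_reach_contract {R : Finset A} (hR : ∀ a ∈ R, D.IsCyclicArc a) {u v : V}
    (h : (D.contract R).Reach (Quot.mk _ u) (Quot.mk _ v)) : D.Reach u v := by
  let reachFrom : Quot (D.JoinedBy (R : Set A)) → Prop := Quot.lift (D.Reach u) fun _ _ h => by
    obtain ⟨a, ha, rfl, rfl⟩ := h
    exact propext ⟨fun h => h.tail (D.joinedBy_univ a),
      fun h => h.trans ((isCyclicArc_iff_reach a).1 (hR a ha))⟩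
  suffices ∀ x, (D.contract R).Reach (Quot.mk _ u) x → reachFrom x from this _ h
  intro x hx
  induction hx with
  | refl => exact Relation.ReflTransGen.refl
  | tail _ hxy ih =>
    obtain ⟨a, -, rfl, rfl⟩ := hxy
    exact Relation.ReflTransGen.tail ih (D.joinedBy_univ a)

theorem isAcyclic_contract {R : Finset A} (hR : ∀ a, a ∈ R ↔ D.IsCyclicArc a) :
    (D.contract R).IsAcyclic :=
  isAcyclic_iff_not_reach.2 fun a h =>
    a.2 ((hR a).2 ((isCyclicArc_iff_reach _).2 (reach_of_reach_contract (fun b => (hR b).1) h)))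

end Reach

section ComponentCount

variable {V A : Type*}

theorem componentCount_contract (D : MultiDigraph V A) (R : Finset A) :
    (D.contract R).componentCount = D.componentCount := by
  classical
  refine Nat.card_congr ⟨Quot.lift (Quot.lift (Quot.mk _) ?_) ?_,
    Quot.lift (fun v => Quot.mk _ (Quot.mk _ v)) ?_, ?_, ?_⟩
  · rintro u v ⟨a, -, h⟩
    exact Quot.sound ⟨a, Set.mem_univ a, h⟩
  · rintro u v ⟨a, -, rfl, rfl⟩
    exact Quot.sound (D.joinedBy_univ a)
  · rintro u v ⟨a, -, rfl, rfl⟩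
    by_cases ha : a ∈ R
    · exact congrArg (Quot.mk _) (Quot.sound ⟨a, ha, rfl, rfl⟩)
    · exact Quot.sound ((D.contract R).joinedBy_univ ⟨a, ha⟩)
  · rintro ⟨⟨v⟩⟩
    rfl
  · rintro ⟨v⟩
    rfl

theorem componentCount_reorient [DecidableEq A] (D : MultiDigraph V A) (T : Finset A) :
    (D.reorient T).componentCount = D.componentCount := by
  refine Nat.card_congr ⟨Quot.lift (Quot.mk _) ?_, Quot.lift (Quot.mk _) ?_, ?_, ?_⟩
  · rintro u v ⟨a, -, rfl, rfl⟩
    have h := Quot.sound (D.joinedBy_univ a)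
    by_cases ha : a ∈ T
    · simpa [reorient, ha] using h.symm
    · simpa [reorient, ha] using h
  · rintro u v ⟨a, -, rfl, rfl⟩
    have h := Quot.sound ((D.reorient T).joinedBy_univ a)
    by_cases ha : a ∈ T
    · simpa [reorient, ha] using h.symm
    · simpa [reorient, ha] using h
  · rintro ⟨v⟩
    rfl
  · rintro ⟨v⟩
    rfl

end ComponentCount

section Expansion

variable {A K : Type*} [CommRing K]

theorem prod_neg_one_sub_natCast (p : ℕ) :
    ∏ i ∈ Finset.range p, (-1 - (i : K)) = (-1) ^ p * (p.factorial : K) := by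
  rw [← Finset.prod_range_add_one_eq_factorial, Nat.cast_prod]
  simpa [neg_sub_left, add_comm] using
    Finset.prod_neg (s := Finset.range p) fun i => ((i + 1 : ℕ) : K)

variable [Fintype A] [DecidableEq A]

theorem prod_piecewise_apply {ι : Type*} (R : Finset A) (φ ψ : A → ι → K) (c : A → ι) :
    ∏ a, R.piecewise φ ψ a (c a) =
      (∏ a ∈ R, φ a (c a)) * ∏ a : {a // a ∉ R}, ψ a (c a) := by
  rw [← Finset.prod_subtype Rᶜ (by simp) fun a => ψ a (c a), ← Finset.prod_mul_prod_compl R]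
  refine congrArg₂ _ (Finset.prod_congr rfl fun a ha => ?_) (Finset.prod_congr rfl fun a ha => ?_)
  · rw [R.piecewise_eq_of_mem _ _ ha]
  · rw [R.piecewise_eq_of_notMem _ _ (Finset.mem_compl.1 ha)]

theorem prod_mul_add_mul (x y : K) (α β : A → K) :
    ∏ a, (x * α a + y * β a) =
      ∑ S : Finset A, x ^ S.card * y ^ Sᶜ.card * ∏ a, S.piecewise α β a := by
  rw [Finset.prod_add, Finset.powerset_univ]
  refine Finset.sum_congr rfl fun S _ => ?_
  simp only [Finset.prod_piecewise, Finset.univ_inter, ← Finset.compl_eq_univ_sdiff,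
    Finset.prod_mul_distrib, Finset.prod_const]
  ring

theorem mem_triPartitions_iff {R S T : Finset A} :
    (R, S, T) ∈ triPartitions A ↔ T ⊆ Rᶜ ∧ S = Rᶜ \ T := by
  simp only [triPartitions, Finset.mem_filter_univ, Finset.disjoint_left, Finset.ext_iff,
    Finset.subset_iff, Finset.mem_union, Finset.mem_univ, Finset.mem_sdiff, Finset.mem_compl]
  grind

theorem sum_triPartitions {M : Type*} [AddCommMonoid M]
    (f : Finset A × Finset A × Finset A → M) :
    ∑ p ∈ triPartitions A, f p = ∑ R : Finset A, ∑ T ∈ Rᶜ.powerset, f (R, Rᶜ \ T, T) := by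
  rw [Finset.sum_sigma']
  refine Finset.sum_bij' (fun p _ => ⟨p.1, p.2.2⟩) (fun q _ => (q.1, q.1ᶜ \ q.2, q.2))
    ?_ ?_ ?_ (fun _ _ => rfl) ?_
  all_goals rintro ⟨R, S, T⟩ h
  · simpa using (mem_triPartitions_iff.1 h).1
  · simpa [mem_triPartitions_iff] using h
  · exact congrArg (fun S => (R, S, T)) (mem_triPartitions_iff.1 h).2.symm
  · exact congrArg (fun S => f (R, S, T)) (mem_triPartitions_iff.1 h).2

theorem prod_add_mul_add_mul (y z : K) (α β γ : A → K) :
    ∏ a, (α a + y * β a + z * γ a) =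
      ∑ p ∈ triPartitions A, y ^ p.2.1.card * z ^ p.2.2.card *
        ∏ a, p.1.piecewise α (p.2.2.piecewise γ β) a := by
  simp only [add_assoc, add_comm (y * _), Finset.prod_add, sum_triPartitions,
    ← Finset.compl_eq_univ_sdiff, Finset.powerset_univ, Finset.mul_sum]
  refine Finset.sum_congr rfl fun R _ => Finset.sum_congr rfl fun T hT => ?_
  rw [Finset.mem_powerset] at hT
  simp only [Finset.prod_piecewise, Finset.univ_inter, ← Finset.compl_eq_univ_sdiff,
    Finset.prod_mul_distrib, Finset.prod_const, Finset.inter_eq_right.2 hT]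
  ring

end Expansion

section SignedSum

variable {V A K : Type*}

/-- The weight of an arc `(u, v)` under a coloring `f`, as a function of the comparison of `f u`
with `f v`: `y` for ascents, `z` for descents and `x` for arcs with both ends of the same color. -/
def arcWeight (x y z : K) : Ordering → K
  | .lt => y
  | .eq => x
  | .gt => z

theorem arcWeight_swap (x y z : K) (o : Ordering) :
    arcWeight x y z o.swap = arcWeight x z y o := by
  cases o <;> rfl

variable [Fintype A] [CommRing K]

theorem prod_arcWeight_cmp (D : MultiDigraph V A) {p : ℕ} (g : V → Fin p) (y z : K) :
    ∏ a, arcWeight 1 y z (cmp (g (D.src a)) (g (D.tgt a))) =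
      y ^ (D.ascents g).card * z ^ (D.descents g).card := by
  rw [ascents, descents, ← Finset.prod_const, ← Finset.prod_const, Finset.prod_filter,
    Finset.prod_filter, ← Finset.prod_mul_distrib]
  refine Finset.prod_congr rfl fun a _ => ?_
  rcases lt_trichotomy (g (D.src a)) (g (D.tgt a)) with h | h | h
  · simp [arcWeight, h.cmp_eq_lt, h, h.not_gt]
  · simp [arcWeight, h]
  · simp [arcWeight, h.cmp_eq_gt, h, h.not_gt]

variable [Fintype V] [DecidableEq V]

/-- The alternating sum over the surjective colorings `V ↠ [p]` in which the arc `a` contributes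
the factor `φ a`, evaluated at the comparison of the colors of its ends. -/
def signedSum (D : MultiDigraph V A) (φ : A → Ordering → K) : K :=
  alternatingSum fun _ g => ∏ a, φ a (cmp (g (D.src a)) (g (D.tgt a)))

theorem signedSum_const_mul (D : MultiDigraph V A) (x : K) (φ : A → Ordering → K) :
    D.signedSum (fun a o => x * φ a o) = x ^ Fintype.card A * D.signedSum φ := by
  simp only [signedSum, Finset.prod_mul_distrib, Finset.prod_const, Finset.card_univ]
  simpa only [Finset.sum_singleton] using
    alternatingSum_sum {()} (fun _ => x ^ Fintype.card A)
      fun _ _ g => ∏ a, φ a (cmp (g (D.src a)) (g (D.tgt a)))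

theorem signedSum_swap (D : MultiDigraph V A) (φ : A → Ordering → K) :
    D.signedSum (fun a o => φ a o.swap) = D.signedSum φ := by
  rw [signedSum, ← alternatingSum_rev]
  refine congrArg alternatingSum (funext₂ fun p g => Finset.prod_congr rfl fun a _ => ?_)
  simp only [Function.comp_apply, cmp_swap]
  exact congrArg _ (Fin.rev_strictAnti.cmp_map_eq _ _)

theorem coeff_signedSum (D : MultiDigraph V A) {φ : A → Ordering → Polynomial K}
    (hφ : ∀ a o, (φ a o).natDegree ≤ 1) :
    (D.signedSum φ).coeff (Fintype.card A) = D.signedSum fun a o => (φ a o).coeff 1 := by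
  simp only [signedSum, alternatingSum, Polynomial.finsetSum_coeff]
  refine Finset.sum_congr rfl fun p _ => ?_
  rw [show ((-1 : Polynomial K) ^ p) = Polynomial.C ((-1) ^ p) by simp,
    Polynomial.coeff_C_mul, Polynomial.finsetSum_coeff]
  refine congrArg _ (Finset.sum_congr rfl fun g _ => ?_)
  simpa using Polynomial.coeff_prod_of_natDegree_le (s := (Finset.univ : Finset A))
    _ 1 fun a _ => hφ a (cmp (g (D.src a)) (g (D.tgt a)))

theorem bEval_neg_one [Algebra ℚ K] (D : MultiDigraph V A) (y z : K) :
    D.bEval (-1) y z = D.signedSum fun _ => arcWeight 1 y z := by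
  have choose_neg_one (p : ℕ) :
      algebraMap ℚ K (1 / (p.factorial : ℚ)) * ((-1) ^ p * (p.factorial : K)) = (-1) ^ p := by
    rw [mul_left_comm, ← map_natCast (algebraMap ℚ K), ← map_mul,
      one_div_mul_cancel (by exact_mod_cast p.factorial_ne_zero), map_one, mul_one]
  simp only [bEval, bPoly, map_sum, map_mul, map_prod, map_pow, map_sub, MvPolynomial.aeval_X,
    MvPolynomial.aeval_C, Matrix.cons_val_zero, Matrix.cons_val_one, Matrix.cons_val, map_natCast,
    prod_neg_one_sub_natCast, choose_neg_one, signedSum, alternatingSum, prod_arcWeight_cmp]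

variable [DecidableEq A]

theorem signedSum_delete (D : MultiDigraph V A) (R : Finset A) (φ : A → Ordering → K) :
    (D.delete R).signedSum (fun a => φ a) = D.signedSum (R.piecewise 1 φ) := by
  refine congrArg alternatingSum (funext₂ fun p g => ?_)
  simp only [prod_piecewise_apply, Pi.one_apply, Finset.prod_const_one, one_mul]
  rfl

theorem signedSum_contract (D : MultiDigraph V A) (R : Finset A)
    [Fintype (Quot (D.JoinedBy (R : Set A)))] [DecidableEq (Quot (D.JoinedBy (R : Set A)))]
    (φ : A → Ordering → K) :
    (D.contract R).signedSum (fun a => φ a) =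
      D.signedSum (R.piecewise (fun _ => arcWeight 1 0 0) φ) := by
  classical
  refine (alternatingSum_quot _ fun p g =>
    ∏ a : {a // a ∉ R}, φ a (cmp (g (D.src a)) (g (D.tgt a)))).trans ?_
  refine congrArg alternatingSum (funext₂ fun p g => ?_)
  have arcWeight_eq (a : A) : (arcWeight 1 0 0 (cmp (g (D.src a)) (g (D.tgt a))) : K) =
      if g (D.src a) = g (D.tgt a) then 1 else 0 := by
    rcases h : cmp (g (D.src a)) (g (D.tgt a)) <;> simp [arcWeight, ← cmp_eq_eq_iff, h]
  have constant_iff : (∀ u v, D.JoinedBy R u v → g u = g v) ↔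
      ∀ a ∈ R, g (D.src a) = g (D.tgt a) :=
    ⟨fun h a ha => h _ _ ⟨a, ha, rfl, rfl⟩, by rintro h _ _ ⟨a, ha, rfl, rfl⟩; exact h a ha⟩
  simp only [prod_piecewise_apply, arcWeight_eq, Finset.prod_ite_zero, constant_iff,
    Finset.prod_const_one, ite_mul, one_mul, zero_mul]

theorem signedSum_reorient (D : MultiDigraph V A) (T : Finset A) (φ : A → Ordering → K) :
    (D.reorient T).signedSum φ = D.signedSum (T.piecewise (fun a o => φ a o.swap) φ) := by
  refine congrArg alternatingSum (funext₂ fun p g => Finset.prod_congr rfl fun a _ => ?_)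
  by_cases ha : a ∈ T <;> simp [reorient, ha, cmp_swap]

theorem signedSum_mul_add_mul (D : MultiDigraph V A) (x y : K) (α β : A → Ordering → K) :
    D.signedSum (fun a o => x * α a o + y * β a o) =
      ∑ S : Finset A, x ^ S.card * y ^ Sᶜ.card * D.signedSum (S.piecewise α β) := by
  simp only [signedSum, prod_mul_add_mul, alternatingSum_sum, Finset.piecewise, ite_apply]

theorem signedSum_add_mul_add_mul (D : MultiDigraph V A) (y z : K)
    (α β γ : A → Ordering → K) :
    D.signedSum (fun a o => α a o + y * β a o + z * γ a o) =
      ∑ p ∈ triPartitions A, y ^ p.2.1.card * z ^ p.2.2.card *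
        D.signedSum (p.1.piecewise α (p.2.2.piecewise γ β)) := by
  simp only [signedSum, prod_add_mul_add_mul, alternatingSum_sum, Finset.piecewise, ite_apply]

end SignedSum

section Decomposition

variable {V A K : Type*} [Fintype V] [DecidableEq A]

theorem piecewise_piecewise_swap (R T : Finset A) {ε : A → Ordering → K}
    (hε : ∀ a o, ε a o.swap = ε a o) (φ : A → Ordering → K) :
    T.piecewise (fun a o => R.piecewise ε φ a o.swap) (R.piecewise ε φ) =
      R.piecewise ε (T.piecewise (fun a o => φ a o.swap) φ) := by
  ext a o
  by_cases hR : a ∈ R <;> by_cases hT : a ∈ T <;> simp [hR, hT, hε]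

noncomputable instance (D : MultiDigraph V A) (R : Set A) : Fintype (Quot (D.JoinedBy R)) :=
  Fintype.ofFinite _

noncomputable instance (D : MultiDigraph V A) (R : Set A) : DecidableEq (Quot (D.JoinedBy R)) :=
  Classical.decEq _

variable [DecidableEq V] [Fintype A] [CommRing K]

theorem sum_signedSum_reorient_delete (D : MultiDigraph V A) (y z : K) (φ : Ordering → K) :
    ∑ p ∈ triPartitions A, y ^ p.2.1.card * z ^ p.2.2.card *
        ((D.reorient p.2.2).delete p.1).signedSum (fun _ => φ) =
      D.signedSum fun _ o => 1 + y * φ o + z * φ o.swap := by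
  rw [signedSum_add_mul_add_mul D y z (fun _ _ => 1) (fun _ => φ) fun _ o => φ o.swap]
  refine Finset.sum_congr rfl fun p _ => congrArg _ ?_
  rw [signedSum_delete _ _ fun _ => φ, signedSum_reorient,
    piecewise_piecewise_swap p.1 p.2.2 fun _ _ => rfl]
  rfl

theorem sum_signedSum_reorient_contract (D : MultiDigraph V A) (y z : K) (φ : Ordering → K) :
    ∑ p ∈ triPartitions A, y ^ p.2.1.card * z ^ p.2.2.card *
        ((D.reorient p.2.2).contract p.1).signedSum (fun _ => φ) =
      D.signedSum fun _ o => arcWeight 1 0 0 o + y * φ o + z * φ o.swap := by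
  rw [signedSum_add_mul_add_mul D y z (fun _ => arcWeight 1 0 0) (fun _ => φ) fun _ o => φ o.swap]
  refine Finset.sum_congr rfl fun p _ => congrArg _ ?_
  rw [signedSum_contract _ _ fun _ => φ, signedSum_reorient,
    piecewise_piecewise_swap p.1 p.2.2 fun _ => arcWeight_swap 1 0 0]

theorem sum_signedSum_reorient (D : MultiDigraph V A) (y : K) (φ : Ordering → K) :
    ∑ S : Finset A, y ^ S.card * (D.reorient S).signedSum (fun _ => φ) =
      D.signedSum fun _ o => φ o + y * φ o.swap := by
  have := signedSum_mul_add_mul D y 1 (fun _ o => φ o.swap) fun _ => φ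
  simp only [one_pow, mul_one, one_mul] at this
  simp only [signedSum_reorient, ← this, add_comm (φ _)]

theorem sum_signedSum_delete (D : MultiDigraph V A) (y : K) (φ : Ordering → K) :
    ∑ S : Finset A, y ^ Sᶜ.card * (D.delete S).signedSum (fun _ => φ) =
      D.signedSum fun _ o => 1 + y * φ o := by
  have := signedSum_mul_add_mul D 1 y (fun _ _ => 1) fun _ => φ
  simp only [one_pow, one_mul] at this
  rw [this]
  exact Finset.sum_congr rfl fun S _ => congrArg _ (signedSum_delete D S fun _ => φ)

theorem sum_signedSum_contract (D : MultiDigraph V A) (y : K) (φ : Ordering → K) :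
    ∑ S : Finset A, y ^ Sᶜ.card * (D.contract S).signedSum (fun _ => φ) =
      D.signedSum fun _ o => arcWeight 1 0 0 o + y * φ o := by
  have := signedSum_mul_add_mul D 1 y (fun _ => arcWeight 1 0 0) fun _ => φ
  simp only [one_pow, one_mul] at this
  rw [this]
  exact Finset.sum_congr rfl fun S _ => congrArg _ (signedSum_contract D S fun _ => φ)

end Decomposition

section Reciprocity

variable {V A K : Type*} [Fintype V] [DecidableEq V] [Fintype A] [CommRing K]

theorem IsAcyclic.signedSum_strict {D : MultiDigraph V A} (hD : D.IsAcyclic) :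
    D.signedSum (fun _ => arcWeight 0 1 0) = (-1 : K) ^ Fintype.card V := by
  classical
  rw [← alternatingSum_strict hD.wellFounded, signedSum]
  congr! 3 with p g
  have arcWeight_eq (a : A) : (arcWeight 0 1 0 (cmp (g (D.src a)) (g (D.tgt a))) : K) =
      if g (D.src a) < g (D.tgt a) then 1 else 0 := by
    rcases h : cmp (g (D.src a)) (g (D.tgt a)) <;> simp [arcWeight, ← cmp_eq_lt_iff, h]
  simp only [arcWeight_eq, Finset.prod_ite_zero, Finset.prod_const_one]
  have strict_iff : (∀ u v, D.JoinedBy Set.univ u v → g u < g v) ↔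
      ∀ a, g (D.src a) < g (D.tgt a) :=
    ⟨fun h a => h _ _ (D.joinedBy_univ a), by rintro h _ _ ⟨a, -, rfl, rfl⟩; exact h a⟩
  simp only [strict_iff, Finset.mem_univ, forall_const]

theorem signedSum_strict (D : MultiDigraph V A) :
    D.signedSum (fun _ => arcWeight 0 1 0) =
      if D.IsAcyclic then (-1 : K) ^ Fintype.card V else 0 := by
  split_ifs with hD
  · exact hD.signedSum_strict
  rw [isAcyclic_iff_not_reach] at hD
  push Not at hD
  obtain ⟨a, ha⟩ := hD
  have prod_eq_zero (p : ℕ) (g : V → Fin p) :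
      ∏ a, (arcWeight 0 1 0 (cmp (g (D.src a)) (g (D.tgt a))) : K) = 0 := by
    by_contra hne
    have strict (b : A) : g (D.src b) < g (D.tgt b) := by
      by_contra hb
      refine hne (Finset.prod_eq_zero (Finset.mem_univ b) ?_)
      rw [← cmp_eq_lt_iff] at hb
      rcases h : cmp (g (D.src b)) (g (D.tgt b)) <;> simp_all [arcWeight]
    exact (strict a).not_ge (ha.le_of_monotone fun b => (strict b).le)
  simp [signedSum, alternatingSum, prod_eq_zero]

theorem IsAcyclic.signedSum_weak {D : MultiDigraph V A} (hD : D.IsAcyclic) :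
    D.signedSum (fun _ => arcWeight 1 1 0) =
      (-1 : K) ^ Fintype.card V * 0 ^ Fintype.card A := by
  classical
  have weak_eq :
      (arcWeight 1 1 0 : Ordering → K) = fun o => 1 + -1 * arcWeight 0 1 0 o.swap := by
    funext o
    cases o <;> simp [arcWeight]
  have strict_delete (S : Finset A) :
      (D.delete S).signedSum (fun _ o => (arcWeight 0 1 0 o.swap : K)) =
        (-1) ^ Fintype.card V := by
    rw [signedSum_swap (D.delete S) fun _ => arcWeight 0 1 0, (hD.delete S).signedSum_strict]
  have alternating := Fintype.sum_pow_mul_eq_add_pow A (1 : K) (-1)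
  simp only [one_pow, one_mul, add_neg_cancel, ← Finset.card_compl] at alternating
  rw [weak_eq, ← sum_signedSum_delete D (-1) fun o => arcWeight 0 1 0 o.swap]
  simp only [strict_delete, ← Finset.sum_mul, alternating, mul_comm]

theorem signedSum_weak_eq_contract [DecidableEq A] (D : MultiDigraph V A) {R : Finset A}
    (hR : ∀ a ∈ R, D.IsCyclicArc a) :
    D.signedSum (fun _ => arcWeight 1 1 0) =
      (D.contract R).signedSum fun _ => (arcWeight 1 1 0 : Ordering → K) := by
  rw [signedSum_contract D R fun _ => arcWeight 1 1 0]
  refine congrArg alternatingSum (funext₂ fun p g => ?_)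
  by_cases monotone : ∀ a, g (D.src a) ≤ g (D.tgt a)
  · refine Finset.prod_congr rfl fun a _ => ?_
    by_cases ha : a ∈ R
    · have constant := (monotone a).antisymm
        (((isCyclicArc_iff_reach a).1 (hR a ha)).le_of_monotone monotone)
      simp [ha, constant, arcWeight]
    · simp [ha]
  · push Not at monotone
    obtain ⟨a, ha⟩ := monotone
    rw [Finset.prod_eq_zero (Finset.mem_univ a), Finset.prod_eq_zero (Finset.mem_univ a)]
    · by_cases haR : a ∈ R <;> simp [haR, ha.cmp_eq_gt, arcWeight]
    · simp [ha.cmp_eq_gt, arcWeight]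

theorem signedSum_weak (D : MultiDigraph V A) :
    D.signedSum (fun _ => arcWeight 1 1 0) =
      if D.IsTotallyCyclic then (-1 : K) ^ D.componentCount else 0 := by
  classical
  let R : Finset A := {a | D.IsCyclicArc a}
  have mem_R (a : A) : a ∈ R ↔ D.IsCyclicArc a := Finset.mem_filter_univ a
  rw [D.signedSum_weak_eq_contract fun a => (mem_R a).1, (isAcyclic_contract mem_R).signedSum_weak]
  split_ifs with hD
  · have R_eq : R = Finset.univ := Finset.eq_univ_iff_forall.2 fun a => (mem_R a).2 (hD a)
    rw [← Nat.card_eq_fintype_card, ← Nat.card_eq_fintype_card, componentCount]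
    simp [R_eq]
  · obtain ⟨a, ha⟩ := not_forall.1 hD
    have : Nonempty {a // a ∉ R} := ⟨a, mt (mem_R a).1 ha⟩
    rw [zero_pow Fintype.card_ne_zero, mul_zero]

end Reciprocity

section Orientations

variable {V A K : Type*} [Fintype V] [DecidableEq V] [Fintype A] [DecidableEq A] [CommRing K]

theorem sum_filter_eq_neg_one_pow_mul (n : ℕ) {ι : Type*} (s : Finset ι) (P : ι → Prop)
    [DecidablePred P] (c : ι → K) :
    ∑ i ∈ s with P i, c i = (-1) ^ n * ∑ i ∈ s, c i * if P i then (-1) ^ n else 0 := by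
  simp only [mul_ite, mul_zero, ← Finset.sum_filter, ← Finset.sum_mul]
  rw [mul_left_comm, ← mul_pow, neg_one_mul, neg_neg, one_pow, mul_one]

theorem sum_isAcyclic_reorient_delete (D : MultiDigraph V A) (y z : K) :
    ∑ p ∈ triPartitions A with ((D.reorient p.2.2).delete p.1).IsAcyclic,
        y ^ p.2.1.card * z ^ p.2.2.card =
      (-1) ^ Fintype.card V * D.signedSum fun _ => arcWeight 1 (1 + y) (1 + z) := by
  have weight_eq : arcWeight 1 (1 + y) (1 + z) =
      fun o => 1 + y * arcWeight 0 1 0 o + z * arcWeight 0 1 0 o.swap := by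
    funext o; cases o <;> simp [arcWeight]
  rw [weight_eq, ← sum_signedSum_reorient_delete,
    sum_filter_eq_neg_one_pow_mul (Fintype.card V)]
  simp only [signedSum_strict]

theorem sum_isTotallyCyclic_reorient_delete (D : MultiDigraph V A) (y z : K) :
    ∑ p ∈ triPartitions A with ((D.reorient p.2.2).delete p.1).IsTotallyCyclic,
        y ^ p.2.1.card * z ^ p.2.2.card *
          (-1) ^ ((D.reorient p.2.2).delete p.1).componentCount =
      D.signedSum fun _ => arcWeight (1 + y + z) (1 + y) (1 + z) := by
  have weight_eq : arcWeight (1 + y + z) (1 + y) (1 + z) =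
      fun o => 1 + y * arcWeight 1 1 0 o + z * arcWeight 1 1 0 o.swap := by
    funext o; cases o <;> simp [arcWeight]
  rw [weight_eq, ← sum_signedSum_reorient_delete]
  simp only [signedSum_weak, mul_ite, mul_zero, Finset.sum_filter]

theorem sum_isAcyclic_reorient_contract (D : MultiDigraph V A) (y z : K) :
    ∑ p ∈ triPartitions A with ((D.reorient p.2.2).contract p.1).IsAcyclic,
        y ^ p.2.1.card * z ^ p.2.2.card *
          (-1) ^ ((D.reorient p.2.2).contract p.1).vertexCount =
      D.signedSum fun _ => arcWeight 1 y z := by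
  have weight_eq : arcWeight 1 y z =
      fun o => arcWeight 1 0 0 o + y * arcWeight 0 1 0 o + z * arcWeight 0 1 0 o.swap := by
    funext o; cases o <;> simp [arcWeight]
  rw [weight_eq, ← sum_signedSum_reorient_contract]
  simp only [signedSum_strict, mul_ite, mul_zero, Finset.sum_filter, vertexCount,
    Nat.card_eq_fintype_card]

theorem sum_isTotallyCyclic_reorient_contract (D : MultiDigraph V A) (y z : K) :
    ∑ p ∈ triPartitions A with ((D.reorient p.2.2).contract p.1).IsTotallyCyclic,
        y ^ p.2.1.card * z ^ p.2.2.card =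
      (-1) ^ D.componentCount * D.signedSum fun _ => arcWeight (1 + y + z) y z := by
  have weight_eq : arcWeight (1 + y + z) y z =
      fun o => arcWeight 1 0 0 o + y * arcWeight 1 1 0 o + z * arcWeight 1 1 0 o.swap := by
    funext o; cases o <;> simp [arcWeight]
  rw [weight_eq, ← sum_signedSum_reorient_contract,
    sum_filter_eq_neg_one_pow_mul D.componentCount]
  simp only [signedSum_weak, componentCount_contract, componentCount_reorient]

theorem sum_isAcyclic_reorient (D : MultiDigraph V A) (y : K) :
    ∑ S : Finset A with (D.reorient S).IsAcyclic, y ^ S.card =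
      (-1) ^ Fintype.card V * D.signedSum fun _ => arcWeight 0 y 1 := by
  have weight_eq : (fun o => arcWeight 0 y 1 o.swap) =
      fun o => arcWeight 0 1 0 o + y * arcWeight 0 1 0 o.swap := by
    funext o; cases o <;> simp [arcWeight]
  rw [← signedSum_swap, weight_eq, ← sum_signedSum_reorient,
    sum_filter_eq_neg_one_pow_mul (Fintype.card V)]
  simp only [signedSum_strict]

theorem sum_isAcyclic_delete (D : MultiDigraph V A) (y : K) :
    ∑ S : Finset A with (D.delete S).IsAcyclic, y ^ Sᶜ.card =
      (-1) ^ Fintype.card V * D.signedSum fun _ => arcWeight 1 (1 + y) 1 := by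
  have weight_eq : arcWeight 1 (1 + y) 1 = fun o => 1 + y * arcWeight 0 1 0 o := by
    funext o; cases o <;> simp [arcWeight]
  rw [weight_eq, ← sum_signedSum_delete,
    sum_filter_eq_neg_one_pow_mul (Fintype.card V)]
  simp only [signedSum_strict]

theorem sum_isTotallyCyclic_reorient (D : MultiDigraph V A) (y : K) :
    ∑ S : Finset A with (D.reorient S).IsTotallyCyclic, y ^ S.card =
      (-1) ^ D.componentCount * D.signedSum fun _ => arcWeight (1 + y) y 1 := by
  have weight_eq : (fun o => arcWeight (1 + y) y 1 o.swap) =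
      fun o => arcWeight 1 1 0 o + y * arcWeight 1 1 0 o.swap := by
    funext o; cases o <;> simp [arcWeight]
  rw [← signedSum_swap, weight_eq, ← sum_signedSum_reorient,
    sum_filter_eq_neg_one_pow_mul D.componentCount]
  simp only [signedSum_weak, componentCount_reorient]

theorem sum_isTotallyCyclic_contract (D : MultiDigraph V A) (y : K) :
    ∑ S : Finset A with (D.contract S).IsTotallyCyclic, y ^ Sᶜ.card =
      (-1) ^ D.componentCount * D.signedSum fun _ => arcWeight (1 + y) y 0 := by
  have weight_eq : arcWeight (1 + y) y 0 =
      fun o => arcWeight 1 0 0 o + y * arcWeight 1 1 0 o := by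
    funext o; cases o <;> simp [arcWeight]
  rw [weight_eq, ← sum_signedSum_contract,
    sum_filter_eq_neg_one_pow_mul D.componentCount]
  simp only [signedSum_weak, componentCount_contract]

end Orientations

section BEval

variable {V A K : Type*} [Fintype V] [DecidableEq V] [Fintype A] [CommRing K] [Algebra ℚ K]

theorem pow_mul_bEval_neg_one (D : MultiDigraph V A) {x : K} (hx : IsUnit x) (y z : K) :
    x ^ Fintype.card A * D.bEval (-1) (y * Ring.inverse x) (z * Ring.inverse x) =
      D.signedSum fun _ => arcWeight x y z := by
  rw [bEval_neg_one, ← signedSum_const_mul]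
  congr! 2
  funext o
  cases o <;> simp [arcWeight, mul_left_comm x, Ring.mul_inverse_cancel x hx]

theorem coeff_bEval_neg_one (D : MultiDigraph V A) (y : K) :
    (D.bEval (-1) (Polynomial.C y * Polynomial.X) Polynomial.X : Polynomial K).coeff
        (Fintype.card A) =
      D.signedSum fun _ => arcWeight 0 y 1 := by
  rw [bEval_neg_one, coeff_signedSum D fun _ o => ?_]
  · congr! 2
    funext o
    cases o <;> simp [arcWeight, Polynomial.coeff_one]
  · cases o
    · exact (Polynomial.natDegree_C_mul_le y _).trans Polynomial.natDegree_X_le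
    · simp [arcWeight]
    · exact Polynomial.natDegree_X_le

end BEval

end MultiDigraph

theorem theorem6p6_general {V A K : Type*} [Fintype V] [DecidableEq V] [Fintype A] [DecidableEq A]
    [CommRing K] [Algebra ℚ K] (D : MultiDigraph V A) :
    (∀ y z : K,
      ∑ p ∈ MultiDigraph.triPartitions A with ((D.reorient p.2.2).delete p.1).IsAcyclic,
          y ^ p.2.1.card * z ^ p.2.2.card =
        (-1) ^ Fintype.card V * D.bEval (-1) (1 + y) (1 + z)) ∧
    (∀ y z : K, IsUnit (1 + y + z) →
      ∑ p ∈ MultiDigraph.triPartitions A with ((D.reorient p.2.2).delete p.1).IsTotallyCyclic,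
          y ^ p.2.1.card * z ^ p.2.2.card *
            (-1) ^ ((D.reorient p.2.2).delete p.1).componentCount =
        (1 + y + z) ^ Fintype.card A *
          D.bEval (-1) ((1 + y) * Ring.inverse (1 + y + z)) ((1 + z) * Ring.inverse (1 + y + z))) ∧
    (∀ y z : K,
      ∑ p ∈ MultiDigraph.triPartitions A with ((D.reorient p.2.2).contract p.1).IsAcyclic,
          y ^ p.2.1.card * z ^ p.2.2.card *
            (-1) ^ ((D.reorient p.2.2).contract p.1).vertexCount =
        D.bEval (-1) y z) ∧
    (∀ y z : K, IsUnit (1 + y + z) →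
      ∑ p ∈ MultiDigraph.triPartitions A with ((D.reorient p.2.2).contract p.1).IsTotallyCyclic,
          y ^ p.2.1.card * z ^ p.2.2.card =
        (-1) ^ D.componentCount * (1 + y + z) ^ Fintype.card A *
          D.bEval (-1) (y * Ring.inverse (1 + y + z)) (z * Ring.inverse (1 + y + z))) ∧
    (∀ y : K,
      ∑ S : Finset A with (D.reorient S).IsAcyclic, y ^ S.card =
        (-1) ^ Fintype.card V *
          (D.bEval (-1) (Polynomial.C y * Polynomial.X) Polynomial.X : Polynomial K).coeff
            (Fintype.card A)) ∧
    (∀ y : K,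
      ∑ S : Finset A with (D.delete S).IsAcyclic, y ^ (Sᶜ).card =
        (-1) ^ Fintype.card V * D.bEval (-1) (1 + y) 1) ∧
    (∀ y : K, IsUnit (1 + y) →
      ∑ S : Finset A with (D.reorient S).IsTotallyCyclic, y ^ S.card =
        (-1) ^ D.componentCount * (1 + y) ^ Fintype.card A *
          D.bEval (-1) (y * Ring.inverse (1 + y)) (Ring.inverse (1 + y))) ∧
    (∀ y : K, IsUnit (1 + y) →
      ∑ S : Finset A with (D.contract S).IsTotallyCyclic, y ^ (Sᶜ).card =
        (-1) ^ D.componentCount * (1 + y) ^ Fintype.card A *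
          D.bEval (-1) (y * Ring.inverse (1 + y)) 0) := by
  refine ⟨fun y z => ?_, fun y z h => ?_, fun y z => ?_, fun y z h => ?_, fun y => ?_,
    fun y => ?_, fun y h => ?_, fun y h => ?_⟩
  · rw [D.sum_isAcyclic_reorient_delete, D.bEval_neg_one]
  · rw [D.sum_isTotallyCyclic_reorient_delete, D.pow_mul_bEval_neg_one h]
  · rw [D.sum_isAcyclic_reorient_contract, D.bEval_neg_one]
  · rw [D.sum_isTotallyCyclic_reorient_contract, mul_assoc, D.pow_mul_bEval_neg_one h]
  · rw [D.sum_isAcyclic_reorient, D.coeff_bEval_neg_one]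
  · rw [D.sum_isAcyclic_delete, D.bEval_neg_one]
  · rw [D.sum_isTotallyCyclic_reorient, mul_assoc, ← D.pow_mul_bEval_neg_one h, one_mul]
  · rw [D.sum_isTotallyCyclic_contract, mul_assoc, ← D.pow_mul_bEval_neg_one h, zero_mul]

theorem theorem6p6 {V A K : Type*} [Fintype V] [DecidableEq V] [Fintype A] [DecidableEq A]
    [Field K] [CharZero K] (D : MultiDigraph V A) :
    -- deletion and reorientation, acyclic
    (∀ y z : K,
      ∑ p ∈ MultiDigraph.triPartitions A with ((D.reorient p.2.2).delete p.1).IsAcyclic,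
          y ^ p.2.1.card * z ^ p.2.2.card =
        (-1) ^ Fintype.card V * D.bEval (-1) (1 + y) (1 + z)) ∧
    -- deletion and reorientation, totally cyclic
    (∀ y z : K, 1 + y + z ≠ 0 →
      ∑ p ∈ MultiDigraph.triPartitions A with ((D.reorient p.2.2).delete p.1).IsTotallyCyclic,
          y ^ p.2.1.card * z ^ p.2.2.card *
            (-1) ^ ((D.reorient p.2.2).delete p.1).componentCount =
        (1 + y + z) ^ Fintype.card A *
          D.bEval (-1) ((1 + y) / (1 + y + z)) ((1 + z) / (1 + y + z))) ∧
    -- contraction and reorientation, acyclic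
    (∀ y z : K,
      ∑ p ∈ MultiDigraph.triPartitions A with ((D.reorient p.2.2).contract p.1).IsAcyclic,
          y ^ p.2.1.card * z ^ p.2.2.card *
            (-1) ^ ((D.reorient p.2.2).contract p.1).vertexCount =
        D.bEval (-1) y z) ∧
    -- contraction and reorientation, totally cyclic
    (∀ y z : K, 1 + y + z ≠ 0 →
      ∑ p ∈ MultiDigraph.triPartitions A with ((D.reorient p.2.2).contract p.1).IsTotallyCyclic,
          y ^ p.2.1.card * z ^ p.2.2.card =
        (-1) ^ D.componentCount * (1 + y + z) ^ Fintype.card A *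
          D.bEval (-1) (y / (1 + y + z)) (z / (1 + y + z))) ∧
    -- acyclic reorientations: a coefficient of a polynomial in `z` over `K`
    (∀ y : K,
      ∑ S : Finset A with (D.reorient S).IsAcyclic, y ^ S.card =
        (-1) ^ Fintype.card V *
          (D.bEval (-1) (Polynomial.C y * Polynomial.X) Polynomial.X : Polynomial K).coeff
            (Fintype.card A)) ∧
    -- acyclic subgraphs
    (∀ y : K,
      ∑ S : Finset A with (D.delete S).IsAcyclic, y ^ (Sᶜ).card =
        (-1) ^ Fintype.card V * D.bEval (-1) (1 + y) 1) ∧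
    -- totally cyclic reorientations
    (∀ y : K, 1 + y ≠ 0 →
      ∑ S : Finset A with (D.reorient S).IsTotallyCyclic, y ^ S.card =
        (-1) ^ D.componentCount * (1 + y) ^ Fintype.card A *
          D.bEval (-1) (y / (1 + y)) (1 / (1 + y))) ∧
    -- totally cyclic contractions
    (∀ y : K, 1 + y ≠ 0 →
      ∑ S : Finset A with (D.contract S).IsTotallyCyclic, y ^ (Sᶜ).card =
        (-1) ^ D.componentCount * (1 + y) ^ Fintype.card A *
          D.bEval (-1) (y / (1 + y)) 0) := by
  simpa only [isUnit_iff_ne_zero, Ring.inverse_eq_inv', div_eq_mul_inv, one_mul] using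
    theorem6p6_general (K := K) D
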